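/- Let $R$ be a commutative ring with identity and let $A$ be a positively graded commutative differential graded (DG) $R$-algebra: an $R$-complex (indexed homologically) with $A_i=0$ for $i<0$ and an associative, unital, graded commutative product $A\otimes_RA\to A$ that is a chain map. For DG $A$-modules $M,N$ let $\operatorname{Hom}_A(M,N)$ be the complex of (graded) $A$-linear homomorphisms; morphisms of DG $A$-modules are the cycles in $\operatorname{Hom}_A(M,N)_0$. A DG $A$-module $Q$ is semi-projective if $\operatorname{Hom}_A(Q,-)$ preserves surjective morphisms and quasiisomorphisms. Put $\operatorname{Ext}^i_A(M,N)=\operatorname{H}_{-i}(\operatorname{Hom}_A(L,N))$ for a quasiisomorphism $L\to M$ with $L$ semi-projective. Let the Yoneda Ext group $\operatorname{YExt}^i_A(M,N)$ be the $i$-th cohomology of the complex of groups of morphisms from $P_\bullet$ to $N$, where $\cdots\to P_1\to P_0\to M\to 0$ is an exact sequence of DG $A$-modules in which each $P_j$ is a projective object of the category of DG $A$-modules. (Up to isomorphism, these groups do not depend on the choice of $L$ and $P_\bullet$.) Let $\sup(M)\in\mathbb{Z}\cup\{\pm\infty\}$ be the supremum of $\{i\in\mathbb{Z}\mid \operatorname{H}_i(M)\neq0\}$,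 and for $n\in\mathbb{Z}$ let $$\tau(M)_{(\leq n)}=\bigl(\cdots\to 0\to M_n/\operatorname{Im}(\partial^M_{n+1})\to M_{n-1}\to M_{n-2}\to\cdots\bigr),$$ a quotient DG $A$-module of $M$. **Proposition.** Let $C$ be a semi-projective DG $A$-module with $\operatorname{Ext}^1_A(C,C)=0$. Then $\operatorname{YExt}^1_A(C,C)=0$, and for every integer $n\geq\sup(C)$ one has $\operatorname{YExt}^1_A(\tau(C)_{(\leq n)},\tau(C)_{(\leq n)})=0$. -/

import Mathlib

open CategoryTheory

universe v u

/-- A positively graded commutative differential graded `R`-algebra: an `R`-complex (indexed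
homologically) with an associative, unital, graded commutative product `A ⊗ A → A` that is a chain
map (the Leibniz rule), and with `A_i = 0` for `i < 0`.
The product is given by its components `A_i × A_j → A_k`, one for each equation `i + j = k`. -/
structure DGAlgebra (R : Type u) [CommRing R] extends
    HomologicalComplex (ModuleCat.{v} R) (ComplexShape.down ℤ) where
  mul {i j k : ℤ} (h : i + j = k) : X i →ₗ[R] X j →ₗ[R] X k
  one : X 0
  one_mul {i : ℤ} (a : X i) : mul (zero_add i) one a = a
  mul_one {i : ℤ} (a : X i) : mul (add_zero i) a one = a
  mul_assoc {i j k ij jk ijk : ℤ} (h₁ : i + j = ij) (h₂ : j + k = jk) (h₃ : ij + k = ijk)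
    (h₄ : i + jk = ijk) (a : X i) (b : X j) (c : X k) :
    mul h₃ (mul h₁ a b) c = mul h₄ a (mul h₂ b c)
  mul_comm {i j k : ℤ} (h : i + j = k) (h' : j + i = k) (a : X i) (b : X j) :
    mul h a b = (i * j).negOnePow • mul h' b a
  d_mul {i i' j j' k k' : ℤ} (h : i + j = k) (hi : i' + 1 = i) (hj : j' + 1 = j) (hk : k' + 1 = k)
    (h₁ : i' + j = k') (h₂ : i + j' = k') (a : X i) (b : X j) :
    (d k k').hom (mul h a b) =
      mul h₁ ((d i i').hom a) b + i.negOnePow • mul h₂ a ((d j j').hom b)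
  nonneg (i : ℤ) (hi : i < 0) : Subsingleton (X i)

/-- A DG module over a DG `R`-algebra `A`: an `R`-complex `M` with an associative and unital
scalar multiplication `A ⊗ M → M` that is a chain map (the Leibniz rule). -/
structure DGModule {R : Type u} [CommRing R] (A : DGAlgebra.{v} R) extends
    HomologicalComplex (ModuleCat.{v} R) (ComplexShape.down ℤ) where
  smul {i j k : ℤ} (h : i + j = k) : A.X i →ₗ[R] X j →ₗ[R] X k
  one_smul {i : ℤ} (m : X i) : smul (zero_add i) A.one m = m
  mul_smul {i j k ij jk ijk : ℤ} (h₁ : i + j = ij) (h₂ : j + k = jk) (h₃ : ij + k = ijk)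
    (h₄ : i + jk = ijk) (a : A.X i) (b : A.X j) (m : X k) :
    smul h₃ (A.mul h₁ a b) m = smul h₄ a (smul h₂ b m)
  d_smul {i i' j j' k k' : ℤ} (h : i + j = k) (hi : i' + 1 = i) (hj : j' + 1 = j)
    (hk : k' + 1 = k) (h₁ : i' + j = k') (h₂ : i + j' = k') (a : A.X i) (m : X j) :
    (d k k').hom (smul h a m) =
      smul h₁ ((A.d i i').hom a) m + i.negOnePow • smul h₂ a ((d j j').hom m)

namespace DGModule

theorem map_sign_smul {R : Type*} [CommRing R] {M N : Type*} [AddCommGroup M] [AddCommGroup N]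
    [Module R M] [Module R N] (f : M →ₗ[R] N) (e : ℤˣ) (x : M) : f (e • x) = e • f x := by
  simp [Units.smul_def]

variable {R : Type u} [CommRing R] {A : DGAlgebra.{v} R}

/-- A morphism of DG `A`-modules: a chain map that is `A`-linear. -/
@[ext]
structure Hom (M N : DGModule A) where
  toChainMap : M.toHomologicalComplex ⟶ N.toHomologicalComplex
  map_smul {i j k : ℤ} (h : i + j = k) (a : A.X i) (m : M.X j) :
    (toChainMap.f k).hom (M.smul h a m) = N.smul h a ((toChainMap.f j).hom m)

instance : Category (DGModule A) where
  Hom := Hom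
  id M := ⟨𝟙 _, fun _ _ _ => rfl⟩
  comp f g := ⟨f.toChainMap ≫ g.toChainMap, fun h a m => by
    simp [f.map_smul, g.map_smul]⟩

@[ext]
theorem hom_ext {M N : DGModule A} {f g : M ⟶ N} (h : f.toChainMap = g.toChainMap) : f = g :=
  Hom.ext h

instance (M N : DGModule A) : Zero (M ⟶ N) := ⟨⟨0, fun _ _ _ => by simp⟩⟩

instance (M N : DGModule A) : Add (M ⟶ N) :=
  ⟨fun f g => ⟨f.toChainMap + g.toChainMap, fun h a m => by simp [f.map_smul, g.map_smul]⟩⟩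

instance (M N : DGModule A) : Neg (M ⟶ N) :=
  ⟨fun f => ⟨-f.toChainMap, fun h a m => by simp [f.map_smul]⟩⟩

instance (M N : DGModule A) : AddCommGroup (M ⟶ N) where
  add_assoc f g h := hom_ext (add_assoc f.toChainMap g.toChainMap h.toChainMap)
  zero_add f := hom_ext (zero_add f.toChainMap)
  add_zero f := hom_ext (add_zero f.toChainMap)
  add_comm f g := hom_ext (add_comm f.toChainMap g.toChainMap)
  neg_add_cancel f := hom_ext (neg_add_cancel f.toChainMap)
  nsmul := nsmulRec
  zsmul := zsmulRec

instance : Preadditive (DGModule A) where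
  add_comp _ _ _ f g h := hom_ext (Preadditive.add_comp _ _ _ f.toChainMap g.toChainMap
    h.toChainMap)
  comp_add _ _ _ f g h := hom_ext (Preadditive.comp_add _ _ _ f.toChainMap g.toChainMap
    h.toChainMap)

/-- The component `M_i → N_i` of a morphism. -/
abbrev Hom.app {M N : DGModule A} (f : M ⟶ N) (i : ℤ) : M.X i →ₗ[R] N.X i :=
  (Hom.toChainMap f).f i |>.hom

theorem d_d (M : DGModule A) (i j k : ℤ) (x : M.X i) : (M.d j k).hom ((M.d i j).hom x) = 0 := by
  rw [← LinearMap.comp_apply, ← ModuleCat.hom_comp, M.d_comp_d]; rfl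

theorem app_d {M N : DGModule A} (f : M ⟶ N) (i j : ℤ) (x : M.X i) :
    Hom.app f j ((M.d i j).hom x) = (N.d i j).hom (Hom.app f i x) := by
  rw [← LinearMap.comp_apply, ← LinearMap.comp_apply, ← ModuleCat.hom_comp, ← ModuleCat.hom_comp,
    (Hom.toChainMap f).comm]

theorem app_smul {M N : DGModule A} (f : M ⟶ N) {i j k : ℤ} (h : i + j = k) (a : A.X i)
    (m : M.X j) : Hom.app f k (M.smul h a m) = N.smul h a (Hom.app f j m) :=
  Hom.map_smul f h a m

theorem comp_app {M N P : DGModule A} (f : M ⟶ N) (g : N ⟶ P) (i : ℤ) (x : M.X i) :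
    Hom.app (f ≫ g) i x = Hom.app g i (Hom.app f i x) := rfl

theorem hom_ext_app {M N : DGModule A} {f g : M ⟶ N}
    (h : ∀ i (x : M.X i), Hom.app f i x = Hom.app g i x) : f = g :=
  hom_ext (HomologicalComplex.hom_ext _ _ fun i =>
    ModuleCat.hom_ext (LinearMap.ext fun x => h i x))

/-- A morphism of DG modules from its components. -/
def homMk {M N : DGModule A} (f : ∀ i, M.X i →ₗ[R] N.X i)
    (hd : ∀ i j (x : M.X i), j + 1 = i → (N.d i j).hom (f i x) = f j ((M.d i j).hom x))
    (hs : ∀ {i j k : ℤ} (h : i + j = k) (a : A.X i) (m : M.X j),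
      f k (M.smul h a m) = N.smul h a (f j m)) : M ⟶ N :=
  Hom.mk { f := fun i => ModuleCat.ofHom (f i)
           comm' := fun i j h => ModuleCat.hom_ext (LinearMap.ext fun x => hd i j x h) } hs

/-- Surjectivity of a morphism (in every degree). -/
def IsSurjective {M N : DGModule A} (f : M ⟶ N) : Prop :=
  ∀ i, Function.Surjective (Hom.app f i)

/-- A quasiisomorphism of DG modules. -/
def IsQuasiIso {M N : DGModule A} (f : M ⟶ N) : Prop :=
  QuasiIso (Hom.toChainMap f)

/-! ### The complex of `A`-linear homomorphisms -/

/-- `Hom_A(M, N)_n`: the families of `R`-linear maps `f_i : M_i → N_{i+n}` (one for each equation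
`i + n = j`) with `f (a m) = (-1) ^ (n |a|) a f(m)`. -/
def homDeg (M N : DGModule A) (n : ℤ) :
    Submodule R (∀ p : {p : ℤ × ℤ // p.1 + n = p.2}, (M.X p.1.1 →ₗ[R] N.X p.1.2)) where
  carrier := {f | ∀ (p i j k l : ℤ) (h : p + i = k) (h' : p + j = l) (hi : i + n = j)
    (hk : k + n = l) (a : A.X p) (m : M.X i),
    f ⟨(k, l), hk⟩ (M.smul h a m) = (n * p).negOnePow • N.smul h' a (f ⟨(i, j), hi⟩ m)}
  add_mem' hf hg p i j k l h h' hi hk a m := by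
    simp [hf p i j k l h h' hi hk, hg p i j k l h h' hi hk]
  zero_mem' _ _ _ _ _ _ _ _ _ _ _ := by simp
  smul_mem' r f hf p i j k l h h' hi hk a m := by
    simp [hf p i j k l h h' hi hk, smul_comm r]

/-- The component `M_i → N_j` of an element of `Hom_A(M, N)_n`, where `i + n = j`. -/
abbrev homDeg.app {M N : DGModule A} {n : ℤ} (f : homDeg M N n) (i j : ℤ) (h : i + n = j) :
    M.X i →ₗ[R] N.X j :=
  f.1 ⟨(i, j), h⟩

theorem homDeg.map_smul {M N : DGModule A} {n : ℤ} (f : homDeg M N n) {p i j k l : ℤ}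
    (h : p + i = k) (h' : p + j = l) (hi : i + n = j) (hk : k + n = l) (a : A.X p) (m : M.X i) :
    homDeg.app f k l hk (M.smul h a m) =
      (n * p).negOnePow • N.smul h' a (homDeg.app f i j hi m) :=
  f.2 p i j k l h h' hi hk a m

theorem homDeg.ext_app {M N : DGModule A} {n : ℤ} {f g : homDeg M N n}
    (h : ∀ i j hij (m : M.X i), homDeg.app f i j hij m = homDeg.app g i j hij m) : f = g :=
  Subtype.ext (funext fun p => LinearMap.ext fun m => h p.1.1 p.1.2 p.2 m)

theorem homDeg.add_app {M N : DGModule A} {n : ℤ} (f g : homDeg M N n) (i j : ℤ)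
    (h : i + n = j) : homDeg.app (f + g) i j h = homDeg.app f i j h + homDeg.app g i j h := rfl

theorem homDeg.smul_app {M N : DGModule A} {n : ℤ} (r : R) (f : homDeg M N n) (i j : ℤ)
    (h : i + n = j) : homDeg.app (r • f) i j h = r • homDeg.app f i j h := rfl

/-- The differential `f ↦ ∂ ∘ f - (-1) ^ n f ∘ ∂` of the complex `Hom_A(M, N)`. -/
def homDFun {M N : DGModule A} {n n' : ℤ} (h : n' + 1 = n) (f : homDeg M N n) : homDeg M N n' :=
  ⟨fun p =>
    (N.d (p.1.2 + 1) p.1.2).hom ∘ₗ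
        homDeg.app f p.1.1 (p.1.2 + 1) (by have := p.2; omega) -
      n.negOnePow • (homDeg.app f (p.1.1 - 1) p.1.2 (by have := p.2; omega) ∘ₗ
        (M.d p.1.1 (p.1.1 - 1)).hom), by
    intro p i j k l h₁ h₂ hi hk a m
    have e₁ := homDeg.map_smul f h₁ (by omega : p + (j + 1) = l + 1) (by omega) (by omega) a m
    have e₂ := N.d_smul (by omega : p + (j + 1) = l + 1) (by omega : (p - 1) + 1 = p) rfl rfl
      (by omega) h₂ a (homDeg.app f i (j + 1) (by omega) m)
    have e₃ := M.d_smul h₁ (by omega : (p - 1) + 1 = p) (by omega : (i - 1) + 1 = i)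
      (by omega : (k - 1) + 1 = k) (by omega) (by omega) a m
    have e₄ := homDeg.map_smul f (by omega : (p - 1) + i = k - 1)
      (by omega : (p - 1) + (j + 1) = l) (by omega) (by omega) ((A.d p (p - 1)).hom a) m
    have e₅ := homDeg.map_smul f (by omega : p + (i - 1) = k - 1) h₂ (by omega) (by omega) a
      ((M.d i (i - 1)).hom m)
    obtain rfl : n' = n - 1 := by omega
    have s₁ : n.negOnePow * (n * (p - 1)).negOnePow = (n * p).negOnePow := by
      rw [← Int.negOnePow_add]; congr 1; ring
    have s₂ : ((n - 1) * p).negOnePow = (n * p).negOnePow * p.negOnePow := by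
      rw [← Int.negOnePow_sub]; congr 1; ring
    simp only [LinearMap.sub_apply, LinearMap.comp_apply, LinearMap.smul_apply, e₁, e₃,
      map_add, map_sign_smul, e₂, e₄, e₅, smul_add, smul_sub, map_sub, smul_smul]
    rw [s₁, s₂]
    rw [show (n * p).negOnePow * p.negOnePow * n.negOnePow =
      n.negOnePow * (p.negOnePow * (n * p).negOnePow) by ac_rfl,
      mul_comm (n * p).negOnePow p.negOnePow]
    abel⟩

theorem homDFun_app {M N : DGModule A} {n n' : ℤ} (h : n' + 1 = n) (f : homDeg M N n)
    {i i' j j' : ℤ} (hi : i' + 1 = i) (hj : j' + 1 = j) (h₁ : i + n' = j') (h₂ : i + n = j)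
    (h₃ : i' + n = j') (m : M.X i) :
    homDeg.app (homDFun h f) i j' h₁ m =
      (N.d j j').hom (homDeg.app f i j h₂ m) -
        n.negOnePow • homDeg.app f i' j' h₃ ((M.d i i').hom m) := by
  obtain rfl : i' = i - 1 := by omega
  subst hj
  rfl

/-- `homDFun` as an `R`-linear map. -/
def homD (M N : DGModule A) {n n' : ℤ} (h : n' + 1 = n) : homDeg M N n →ₗ[R] homDeg M N n' where
  toFun := homDFun h
  map_add' f g := by
    refine homDeg.ext_app fun i j hij m => ?_
    rw [homDeg.add_app, LinearMap.add_apply]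
    simp only [homDFun_app h _ (sub_add_cancel i 1) rfl hij (by omega) (by omega), homDeg.add_app,
      LinearMap.add_apply, map_add, smul_add]
    abel
  map_smul' r f := by
    refine homDeg.ext_app fun i j hij m => ?_
    rw [RingHom.id_apply, homDeg.smul_app, LinearMap.smul_apply]
    simp only [homDFun_app h _ (sub_add_cancel i 1) rfl hij (by omega) (by omega), homDeg.smul_app,
      LinearMap.smul_apply, map_smul, smul_sub, smul_comm r]

/-- The complex `Hom_A(M, N)`. -/
noncomputable def homComplex (M N : DGModule A) :
    HomologicalComplex (ModuleCat.{v} R) (ComplexShape.down ℤ) where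
  X n := ModuleCat.of R (homDeg M N n)
  d n n' := if h : n' + 1 = n then ModuleCat.ofHom (homD M N h) else 0
  shape n n' h := dif_neg h
  d_comp_d' n n' n'' h h' := by
    change n' + 1 = n at h
    change n'' + 1 = n' at h'
    rw [dif_pos h, dif_pos h', ← ModuleCat.ofHom_comp]
    refine ModuleCat.hom_ext (LinearMap.ext fun f => homDeg.ext_app fun i j hij m => ?_)
    change homDeg.app (homDFun h' (homDFun h f)) i j hij m = 0
    obtain rfl : n' = n - 1 := by omega
    rw [homDFun_app h' _ (sub_add_cancel i 1) rfl hij (by omega) (by omega),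
      homDFun_app h _ (sub_add_cancel i 1) rfl (by omega) (by omega) (by omega),
      homDFun_app h _ (sub_add_cancel (i - 1) 1) rfl (by omega) (by omega) (by omega),
      d_d, map_zero, smul_zero, sub_zero, map_sub, d_d, zero_sub, map_sign_smul,
      Int.negOnePow_sub, Int.negOnePow_one]
    simp

/-- Composition `Hom_A(Q, M)_n → Hom_A(Q, N)_n` with a morphism `f : M → N`. -/
def homPost (Q : DGModule A) {M N : DGModule A} (f : M ⟶ N) (n : ℤ) :
    homDeg Q M n →ₗ[R] homDeg Q N n where
  toFun g := ⟨fun p => Hom.app f p.1.2 ∘ₗ g.1 p, fun p i j k l h h' hi hk a m => by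
    have e := g.2 p i j k l h h' hi hk a m
    simp only [LinearMap.comp_apply, e, map_sign_smul, app_smul]⟩
  map_add' g g' := homDeg.ext_app fun i j hij m => map_add (Hom.app f j) _ _
  map_smul' r g := homDeg.ext_app fun i j hij m => map_smul (Hom.app f j) _ _

theorem homPost_app (Q : DGModule A) {M N : DGModule A} (f : M ⟶ N) {n : ℤ} (g : homDeg Q M n)
    (i j : ℤ) (h : i + n = j) (m : Q.X i) :
    homDeg.app (homPost Q f n g) i j h m = Hom.app f j (homDeg.app g i j h m) := rfl

theorem homD_homPost (Q : DGModule A) {M N : DGModule A} (f : M ⟶ N) {n n' : ℤ} (h : n' + 1 = n)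
    (g : homDeg Q M n) : homD Q N h (homPost Q f n g) = homPost Q f n' (homD Q M h g) := by
  refine homDeg.ext_app fun i j hij m => ?_
  change homDeg.app (homDFun h _) i j hij m = Hom.app f j (homDeg.app (homDFun h _) i j hij m)
  rw [homDFun_app h _ (sub_add_cancel i 1) rfl hij (by omega) (by omega),
    homDFun_app h _ (sub_add_cancel i 1) rfl hij (by omega) (by omega), map_sub, map_sign_smul,
    app_d, homPost_app, homPost_app]

/-- The chain map `Hom_A(Q, f) : Hom_A(Q, M) → Hom_A(Q, N)` induced by a morphism `f : M → N`. -/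
noncomputable def homMap (Q : DGModule A) {M N : DGModule A} (f : M ⟶ N) :
    homComplex Q M ⟶ homComplex Q N where
  f n := ModuleCat.ofHom (homPost Q f n)
  comm' n n' h := by
    change n' + 1 = n at h
    dsimp only [homComplex]
    rw [dif_pos h, dif_pos h, ← ModuleCat.ofHom_comp, ← ModuleCat.ofHom_comp]
    exact congrArg _ (LinearMap.ext fun g => homD_homPost Q f h g)

/-! ### Semi-projective DG modules and Ext -/

/-- `Q` is graded-projective: `Hom_A(Q, -)` preserves surjective morphisms. -/
def IsGradedProjective (Q : DGModule A) : Prop :=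
  ∀ ⦃M N : DGModule A⦄ (f : M ⟶ N), IsSurjective f →
    ∀ n, Function.Surjective ((homMap Q f).f n).hom

/-- `Q` is semi-projective: it is graded-projective and `Hom_A(Q, -)` preserves
quasiisomorphisms. -/
def IsSemiprojective (Q : DGModule A) : Prop :=
  IsGradedProjective Q ∧
    ∀ ⦃M N : DGModule A⦄ (f : M ⟶ N), IsQuasiIso f → QuasiIso (homMap Q f)

/-- A semi-projective resolution of `M`: a quasiisomorphism `L → M` with `L` semi-projective. -/
structure SemiprojectiveResolution (M : DGModule A) where
  L : DGModule A
  semiprojective : IsSemiprojective L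
  π : L ⟶ M
  quasiIso : IsQuasiIso π

/-- `Ext_A^i(M, N) = H_{-i}(RHom_A(M, N)) = H_{-i}(Hom_A(L, N))`, computed by a semi-projective
resolution `L → M`. Up to isomorphism it does not depend on the resolution. -/
noncomputable def Ext {M : DGModule A} (L : SemiprojectiveResolution M) (N : DGModule A) (i : ℤ) :
    ModuleCat.{v} R :=
  (homComplex L.L N).homology (-i)

/-! ### Yoneda Ext -/

/-- A resolution `⋯ → P₁ → P₀ → M → 0` of `M` by categorically projective DG modules, i.e. by
projective objects of the category of DG `A`-modules. -/
structure ProjectiveResolution (M : DGModule A) where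
  P : ℕ → DGModule A
  projective : ∀ j, Projective (P j)
  d : ∀ j, P (j + 1) ⟶ P j
  π : P 0 ⟶ M
  exact_succ : ∀ j i, Function.Exact (Hom.app (d (j + 1)) i) (Hom.app (d j) i)
  exact_zero : ∀ i, Function.Exact (Hom.app (d 0) i) (Hom.app π i)
  surjective : IsSurjective π

/-- The complex `0 → Hom(P₀, N) → Hom(P₁, N) → ⋯` of groups of morphisms of DG modules. -/
noncomputable def ProjectiveResolution.homCochain {M : DGModule A} (P : ProjectiveResolution M)
    (N : DGModule A) : CochainComplex AddCommGrpCat.{v} ℕ :=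
  CochainComplex.of (fun j => AddCommGrpCat.of (P.P j ⟶ N))
    (fun j => AddCommGrpCat.ofHom (Preadditive.leftComp N (P.d j)))
    (fun j => by
      refine AddCommGrpCat.hom_ext (AddMonoidHom.ext fun f => ?_)
      have h : P.d (j + 1) ≫ P.d j = 0 :=
        hom_ext_app fun i x => (P.exact_succ j i).apply_apply_eq_zero x
      change P.d (j + 1) ≫ P.d j ≫ f = 0
      rw [← Category.assoc, h, Limits.zero_comp])

/-- The Yoneda Ext group `YExt_A^i(M, N) = H^i(Hom(P_•, N))`, computed by a resolution `P_• → M` by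
categorically projective DG modules. Up to isomorphism it does not depend on the resolution, and
a resolution exists (`nonempty_projectiveResolution` below). -/
noncomputable def YExt {M : DGModule A} (P : ProjectiveResolution M) (N : DGModule A) (i : ℕ) :
    AddCommGrpCat.{v} :=
  (P.homCochain N).homology i

/-! ### Submodules, quotients, truncations -/

/-- A DG submodule. -/
structure DGSubmodule (M : DGModule A) where
  carrier (i : ℤ) : Submodule R (M.X i)
  d_mem (i j : ℤ) (x : M.X i) : x ∈ carrier i → (M.d i j).hom x ∈ carrier j
  smul_mem {i j k : ℤ} (h : i + j = k) (a : A.X i) (x : M.X j) :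
    x ∈ carrier j → M.smul h a x ∈ carrier k

/-- A DG submodule as a DG module. -/
def DGSubmodule.toDGModule {M : DGModule A} (S : DGSubmodule M) : DGModule A where
  X i := ModuleCat.of R (S.carrier i)
  d i j := ModuleCat.ofHom ((M.d i j).hom.restrict (S.d_mem i j))
  shape i j h := ModuleCat.hom_ext (LinearMap.ext fun x => Subtype.ext (by
    change (M.d i j).hom x.1 = 0
    rw [M.shape i j h]; rfl))
  d_comp_d' i j k _ _ := ModuleCat.hom_ext (LinearMap.ext fun x => Subtype.ext (d_d M i j k x.1))
  smul h := LinearMap.mk₂ R (fun a x => ⟨M.smul h a x.1, S.smul_mem h a x.1 x.2⟩)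
    (fun a b x => Subtype.ext (by simp)) (fun r a x => Subtype.ext (by simp))
    (fun a x y => Subtype.ext (by simp)) (fun r a x => Subtype.ext (by simp))
  one_smul x := Subtype.ext (M.one_smul x.1)
  mul_smul h₁ h₂ h₃ h₄ a b x := Subtype.ext (M.mul_smul h₁ h₂ h₃ h₄ a b x.1)
  d_smul h hi hj hk h₁ h₂ a x := Subtype.ext (M.d_smul h hi hj hk h₁ h₂ a x.1)

/-- The inclusion of a DG submodule. -/
def DGSubmodule.incl {M : DGModule A} (S : DGSubmodule M) : S.toDGModule ⟶ M :=
  homMk (fun i => (S.carrier i).subtype) (fun _ _ _ _ => rfl) (fun _ _ _ => rfl)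

/-- The quotient `M / M'` by a DG submodule. -/
def DGSubmodule.quotient {M : DGModule A} (S : DGSubmodule M) : DGModule A where
  X i := ModuleCat.of R (M.X i ⧸ S.carrier i)
  d i j := ModuleCat.ofHom ((S.carrier i).mapQ (S.carrier j) (M.d i j).hom (S.d_mem i j))
  shape i j h := ModuleCat.hom_ext (Submodule.linearMap_qext _ (LinearMap.ext fun x => by
    change (S.carrier j).mkQ ((M.d i j).hom x) = 0
    rw [M.shape i j h]; exact map_zero _))
  d_comp_d' i j k _ _ := ModuleCat.hom_ext (Submodule.linearMap_qext _ (LinearMap.ext fun x => by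
    change (S.carrier k).mkQ ((M.d j k).hom ((M.d i j).hom x)) = 0
    rw [d_d, map_zero]))
  smul {i j k} h := LinearMap.mk₂ R
    (fun a => (S.carrier j).mapQ (S.carrier k) (M.smul h a) (S.smul_mem h a))
    (fun a b x => by
      obtain ⟨x, rfl⟩ := Submodule.Quotient.mk_surjective _ x
      simp)
    (fun r a x => by
      obtain ⟨x, rfl⟩ := Submodule.Quotient.mk_surjective _ x
      simp)
    (fun a x y => map_add _ x y) (fun r a x => map_smul _ r x)
  one_smul x := by
    obtain ⟨x, rfl⟩ := Submodule.Quotient.mk_surjective _ x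
    exact congrArg (Submodule.mkQ _) (M.one_smul x)
  mul_smul h₁ h₂ h₃ h₄ a b x := by
    obtain ⟨x, rfl⟩ := Submodule.Quotient.mk_surjective _ x
    exact congrArg (Submodule.mkQ _) (M.mul_smul h₁ h₂ h₃ h₄ a b x)
  d_smul h hi hj hk h₁ h₂ a x := by
    obtain ⟨x, rfl⟩ := Submodule.Quotient.mk_surjective _ x
    exact (congrArg (Submodule.mkQ _) (M.d_smul h hi hj hk h₁ h₂ a x)).trans
      ((map_add _ _ _).trans (congrArg _ (map_sign_smul _ _ _)))

/-- The projection `M → M / M'`. -/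
def DGSubmodule.proj {M : DGModule A} (S : DGSubmodule M) : M ⟶ S.quotient :=
  homMk (fun i => (S.carrier i).mkQ) (fun _ _ _ _ => rfl) (fun _ _ _ => rfl)

/-- The DG submodule `⋯ → M_{n+2} → M_{n+1} → Im(∂_{n+1}) → 0` of `M`. -/
def truncSubmodule (M : DGModule A) (n : ℤ) : DGSubmodule M where
  carrier i := if n < i then ⊤ else if i = n then LinearMap.range (M.d (n + 1) i).hom else ⊥
  d_mem i j x hx := by
    by_cases hij : j + 1 = i
    · by_cases h₁ : n < j
      · rw [if_pos h₁]; trivial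
      · rw [if_neg h₁]
        by_cases h₂ : j = n
        · rw [if_pos h₂]
          obtain rfl : i = n + 1 := by omega
          exact ⟨x, rfl⟩
        · rw [if_neg (by omega)] at hx
          have hx : (M.d i j).hom x = 0 := by
            split_ifs at hx with h₃
            · obtain ⟨y, rfl⟩ := hx
              exact d_d M _ _ _ y
            · rw [(Submodule.mem_bot R).1 hx, map_zero]
          rw [hx]
          exact Submodule.zero_mem _
    · rw [M.shape i j hij]
      exact Submodule.zero_mem _
  smul_mem {i j k} h a x hx := by
    by_cases h₁ : n < k
    · rw [if_pos h₁]; trivial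
    · rcases lt_or_ge i 0 with hi | hi
      · have := A.nonneg i hi
        rw [Subsingleton.elim a 0, map_zero, LinearMap.zero_apply]
        exact Submodule.zero_mem _
      · rw [if_neg (by omega)] at hx
        split_ifs at hx with h₃
        · obtain ⟨y, rfl⟩ := hx
          rw [if_neg h₁]
          obtain ⟨rfl, rfl⟩ : i = 0 ∧ j = k := by omega
          rw [if_pos h₃]
          subst h₃
          have e := M.d_smul (by omega : 0 + (j + 1) = j + 1) (by omega : (-1 : ℤ) + 1 = 0)
            rfl rfl (by omega) h a y
          have := A.nonneg (-1) (by omega)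
          refine ⟨M.smul (by omega) a y, ?_⟩
          rw [e, Subsingleton.elim ((A.d 0 (-1)).hom a) 0]
          simp
        · rw [(Submodule.mem_bot R).1 hx, map_zero]
          exact Submodule.zero_mem _

/-- The soft left truncation `τ(M)_{(≤ n)} = ⋯ → 0 → M_n / Im(∂_{n+1}) → M_{n-1} → ⋯`. -/
def trunc (M : DGModule A) (n : ℤ) : DGModule A := (truncSubmodule M n).quotient

/-- The supremum of `M`: the supremum of `{n | H_n(M) ≠ 0}` in `ℤ ∪ {-∞, ∞}`. -/
noncomputable def sup (M : DGModule A) : WithBot (WithTop ℤ) :=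
  sSup {x | ∃ n : ℤ, x = ((n : WithTop ℤ) : WithBot (WithTop ℤ)) ∧
    ¬ Limits.IsZero (M.toHomologicalComplex.homology n)}

/-! ### Existence of resolutions by categorically projective DG modules -/

/-- Transport along an equality of degrees. -/
def castX (A : DGAlgebra.{v} R) {p q : ℤ} (h : p = q) : A.X p →ₗ[R] A.X q :=
  (eqToHom (congrArg A.X h)).hom

theorem castX_castX {p q r : ℤ} (h : p = q) (h' : q = r) (a : A.X p) :
    castX A h' (castX A h a) = castX A (h.trans h') a := by
  subst h h'; rfl

theorem d_castX {p q p' q' : ℤ} (h : p = q) (h' : p' = q') (a : A.X p) :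
    (A.d q q').hom (castX A h a) = castX A h' ((A.d p p').hom a) := by
  subst h h'; rfl

theorem mul_castX {i p q k k' : ℤ} (h : p = q) (h' : k = k') (h₁ : i + p = k) (h₂ : i + q = k')
    (a : A.X i) (b : A.X p) : A.mul h₂ a (castX A h b) = castX A h' (A.mul h₁ a b) := by
  subst h h'; rfl

theorem mul_castX_one {p q : ℤ} (h : 0 = q) (h₁ : p + q = p) (a : A.X p) :
    A.mul h₁ a (castX A h A.one) = a := by
  subst h; exact A.mul_one a

theorem smul_castX {M : DGModule A} {p q j k : ℤ} (h : p = q) (h₁ : p + j = k) (h₂ : q + j = k)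
    (a : A.X p) (m : M.X j) : M.smul h₂ (castX A h a) m = M.smul h₁ a m := by
  subst h; rfl

theorem smul_castX_one {M : DGModule A} {q j : ℤ} (h : 0 = q) (h₁ : q + j = j) (m : M.X j) :
    M.smul h₁ (castX A h A.one) m = m := by
  subst h; exact M.one_smul m

theorem d_castX_one {q q' : ℤ} (h : 0 = q) (h' : q' + 1 = q) :
    (A.d q q').hom (castX A h A.one) = 0 :=
  have := A.nonneg q' (by omega)
  Subsingleton.elim _ _

theorem dA_dA (i j k : ℤ) (x : A.X i) : (A.d j k).hom ((A.d i j).hom x) = 0 := by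
  rw [← LinearMap.comp_apply, ← ModuleCat.hom_comp, A.d_comp_d]; rfl

/-- The differential `a e + b ∂e ↦ ∂(a) e + ((-1) ^ |a| a + ∂(b)) ∂e` of the free DG module on a
generator `e` of degree `j`. -/
def discD (A : DGAlgebra.{v} R) (j : ℤ) {k k' : ℤ} (h : k' + 1 = k) :
    (A.X (k - j) × A.X (k - j + 1)) →ₗ[R] (A.X (k' - j) × A.X (k' - j + 1)) where
  toFun x := ((A.d _ _).hom x.1,
    (k - j).negOnePow • castX A (by omega) x.1 + (A.d _ _).hom x.2)
  map_add' x y := Prod.ext (by simp) (by simp; abel)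
  map_smul' r x := Prod.ext (by simp) (by simp [smul_comm r])

theorem discD_discD (A : DGAlgebra.{v} R) (j : ℤ) {k k' k'' : ℤ} (h : k' + 1 = k)
    (h' : k'' + 1 = k') (x : A.X (k - j) × A.X (k - j + 1)) :
    discD A j h' (discD A j h x) = 0 := by
  refine Prod.ext (dA_dA _ _ _ x.1) ?_
  change (k' - j).negOnePow • castX A _ ((A.d _ _).hom x.1) +
    (A.d _ _).hom ((k - j).negOnePow • castX A _ x.1 + (A.d _ _).hom x.2) = 0
  rw [map_add, dA_dA, map_sign_smul, d_castX _ (by omega : k' - j = k'' - j + 1), add_zero,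
    show (k - j).negOnePow = -(k' - j).negOnePow by rw [← Int.negOnePow_succ]; congr 1; omega]
  simp

/-- The scalar multiplication `a (b e + c ∂e) = (a b) e + (a c) ∂e`. -/
def discSmul (A : DGAlgebra.{v} R) (j : ℤ) {p k l : ℤ} (h : p + k = l) :
    A.X p →ₗ[R] (A.X (k - j) × A.X (k - j + 1)) →ₗ[R] (A.X (l - j) × A.X (l - j + 1)) :=
  LinearMap.mk₂ R
    (fun a x => (A.mul (by omega : p + (k - j) = l - j) a x.1,
      A.mul (by omega : p + (k - j + 1) = l - j + 1) a x.2))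
    (fun a b x => Prod.ext (by simp) (by simp)) (fun r a x => Prod.ext (by simp) (by simp))
    (fun a x y => Prod.ext (by simp) (by simp)) (fun r a x => Prod.ext (by simp) (by simp))

theorem discD_discSmul (A : DGAlgebra.{v} R) (j : ℤ) {p p' k k' l l' : ℤ} (h : p + k = l)
    (hp : p' + 1 = p) (hk : k' + 1 = k) (hl : l' + 1 = l) (h₁ : p' + k = l') (h₂ : p + k' = l')
    (a : A.X p) (x : A.X (k - j) × A.X (k - j + 1)) :
    discD A j hl (discSmul A j h a x) =
      discSmul A j h₁ ((A.d p p').hom a) x + p.negOnePow • discSmul A j h₂ a (discD A j hk x) := by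
  refine Prod.ext (A.d_mul _ hp (by omega) (by omega) _ _ a x.1) ?_
  change (l - j).negOnePow • castX A _ (A.mul _ a x.1) + (A.d _ _).hom (A.mul _ a x.2) =
    A.mul _ ((A.d p p').hom a) x.2 + p.negOnePow • A.mul _ a
      ((k - j).negOnePow • castX A _ x.1 + (A.d _ _).hom x.2)
  rw [A.d_mul (by omega : p + (k - j + 1) = l - j + 1) hp (by omega : k' - j + 1 + 1 = k - j + 1)
    (by omega) (by omega) (by omega) a x.2, map_add,
    map_sign_smul, mul_castX _ (by omega : l - j = l' - j + 1) (by omega), smul_add, smul_smul,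
    ← Int.negOnePow_add,
    show (p + (k - j)).negOnePow = (l - j).negOnePow by congr 1; omega]
  abel

/-- The free DG module on a generator `e` of degree `j`: its underlying graded module is free on
`e` and `∂e`. -/
noncomputable def disc (A : DGAlgebra.{v} R) (j : ℤ) : DGModule A where
  X k := ModuleCat.of R (A.X (k - j) × A.X (k - j + 1))
  d k k' := if h : k' + 1 = k then ModuleCat.ofHom (discD A j h) else 0
  shape k k' h := dif_neg h
  d_comp_d' k k' k'' h h' := by
    change k' + 1 = k at h
    change k'' + 1 = k' at h'
    rw [dif_pos h, dif_pos h', ← ModuleCat.ofHom_comp]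
    exact ModuleCat.hom_ext (LinearMap.ext fun x => discD_discD A j h h' x)
  smul h := discSmul A j h
  one_smul x := Prod.ext (A.one_mul x.1) (A.one_mul x.2)
  mul_smul h₁ h₂ h₃ h₄ a b x := Prod.ext (A.mul_assoc _ _ _ _ a b x.1) (A.mul_assoc _ _ _ _ a b x.2)
  d_smul h hi hj hk h₁ h₂ a x := by
    rw [dif_pos hk, dif_pos hj]
    exact discD_discSmul A j h hi hj hk h₁ h₂ a x

/-- The generator `e` of the free DG module on one generator. -/
noncomputable def discGen (A : DGAlgebra.{v} R) (j : ℤ) : (disc A j).X j :=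
  (castX A (sub_self j).symm A.one, (0 : A.X (j - j + 1)))

/-- The morphism `a e + b ∂e ↦ a m + b ∂m`. -/
noncomputable def discHom {M : DGModule A} {j : ℤ} (m : M.X j) : disc A j ⟶ M :=
  homMk (fun k => (((M.smul (by omega : k - j + j = k)).flip m).coprod
      ((M.smul (by omega : k - j + 1 + (j - 1) = k)).flip ((M.d j (j - 1)).hom m)) :
        (A.X (k - j) × A.X (k - j + 1)) →ₗ[R] M.X k))
    (fun k k' x h => by
      have e : (disc A j).d k k' = ModuleCat.ofHom (discD A j h) := dif_pos h
      rw [e]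
      obtain ⟨a, b⟩ := x
      change (M.d k k').hom (M.smul _ a m + M.smul _ b ((M.d j (j - 1)).hom m)) =
        M.smul _ ((A.d _ _).hom a) m + M.smul _ ((k - j).negOnePow • castX A _ a +
          (A.d _ _).hom b) ((M.d j (j - 1)).hom m)
      rw [map_add, M.d_smul _ (by omega : k' - j + 1 = k - j) (by omega : j - 1 + 1 = j) h
        (by omega) (by omega) a m,
        M.d_smul _ (by omega : k' - j + 1 + 1 = k - j + 1) (by omega : j - 1 - 1 + 1 = j - 1) h
        (by omega) (by omega) b, d_d, map_add, map_zero, smul_zero, add_zero, LinearMap.add_apply,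
        map_sign_smul, LinearMap.smul_apply,
        smul_castX _ (by omega : k - j + (j - 1) = k'), add_assoc])
    (fun {p k l} h a x => by
      obtain ⟨b, c⟩ := x
      change M.smul _ (A.mul _ a b) m + M.smul _ (A.mul _ a c) _ =
        M.smul h a (M.smul _ b m + M.smul _ c _)
      rw [map_add, M.mul_smul _ _ _ h, M.mul_smul _ _ _ h])

theorem discHom_app {M : DGModule A} {j : ℤ} (m : M.X j) (k : ℤ) (a : A.X (k - j))
    (b : A.X (k - j + 1)) :
    Hom.app (discHom m) k ((a, b) : A.X (k - j) × A.X (k - j + 1)) =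
      M.smul (by omega) a m + M.smul (by omega) b ((M.d j (j - 1)).hom m) := rfl

theorem discHom_gen {M : DGModule A} {j : ℤ} (m : M.X j) :
    Hom.app (discHom m) j (discGen A j) = m := by
  rw [discGen, discHom_app, smul_castX_one, map_zero, LinearMap.zero_apply, add_zero]

theorem discHom_app_gen {M : DGModule A} {j : ℤ} (f : disc A j ⟶ M) :
    discHom (Hom.app f j (discGen A j)) = f := by
  refine hom_ext_app fun k x => ?_
  obtain ⟨a, b⟩ := x
  rw [discHom_app, ← app_d, ← app_smul, ← app_smul, ← map_add]
  refine congrArg _ ?_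
  have e : (disc A j).d j (j - 1) = ModuleCat.ofHom (discD A j (by omega)) := dif_pos (by omega)
  rw [e]
  refine Prod.ext ?_ ?_
  · change A.mul _ a (castX A _ A.one) + A.mul _ b ((A.d _ _).hom (castX A _ A.one)) = a
    rw [mul_castX_one, d_castX_one _ (by omega), map_zero, add_zero]
  · change A.mul _ a 0 + A.mul _ b ((j - j).negOnePow • castX A _ (castX A _ A.one) +
      (A.d _ _).hom 0) = b
    rw [map_zero, map_zero, zero_add, add_zero,
      show (j - j).negOnePow = 1 by rw [sub_self, Int.negOnePow_zero], _root_.one_smul, castX_castX,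
      mul_castX_one]

/-- The direct sum of a family of DG modules. -/
noncomputable def directSum {I : Type v} (F : I → DGModule A) : DGModule A where
  X k := ModuleCat.of R (DirectSum I fun i => (F i).X k)
  d k k' := ModuleCat.ofHom (DirectSum.lmap fun i => ((F i).d k k').hom)
  shape k k' h := ModuleCat.hom_ext (LinearMap.ext fun x => DFinsupp.ext fun i => by
    change ((F i).d k k').hom (x i) = 0
    rw [(F i).shape k k' h]; rfl)
  d_comp_d' k k' k'' _ _ := ModuleCat.hom_ext (LinearMap.ext fun x => DFinsupp.ext fun i =>
    d_d (F i) k k' k'' (x i))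
  smul h := LinearMap.mk₂ R (fun a => DirectSum.lmap fun i => (F i).smul h a)
    (fun a b x => DFinsupp.ext fun i => LinearMap.congr_fun (map_add ((F i).smul h) a b) (x i))
    (fun r a x => DFinsupp.ext fun i => LinearMap.congr_fun (map_smul ((F i).smul h) r a) (x i))
    (fun a x y => map_add _ x y) (fun r a x => map_smul _ r x)
  one_smul x := by
    refine DFinsupp.ext fun i => (F i).one_smul (x i)
  mul_smul h₁ h₂ h₃ h₄ a b x := by
    refine DFinsupp.ext fun i => (F i).mul_smul h₁ h₂ h₃ h₄ a b (x i)
  d_smul h hi hj hk h₁ h₂ a x := by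
    refine DFinsupp.ext fun i => (F i).d_smul h hi hj hk h₁ h₂ a (x i)

open Classical in
/-- The inclusion of a summand. -/
noncomputable def directSumIncl {I : Type v} (F : I → DGModule A) (i : I) : F i ⟶ directSum F :=
  homMk (fun k => DirectSum.lof R I (fun i => (F i).X k) i)
    (fun k k' x _ => DirectSum.lmap_lof (fun i => ((F i).d k k').hom) i x)
    (fun h a x => (DirectSum.lmap_lof (fun i => (F i).smul h a) i x).symm)

open Classical in
/-- The morphism from a direct sum given by its components. -/
noncomputable def directSumDesc {I : Type v} {F : I → DGModule A} {N : DGModule A}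
    (f : ∀ i, F i ⟶ N) : directSum F ⟶ N :=
  homMk (fun k => DirectSum.toModule R I (N.X k) (fun i => Hom.app (f i) k))
    (fun k k' x _ => by
      refine LinearMap.congr_fun (DirectSum.linearMap_ext R fun i => LinearMap.ext fun y => ?_ :
        (N.d k k').hom ∘ₗ DirectSum.toModule R I (N.X k) (fun i => Hom.app (f i) k) =
        DirectSum.toModule R I (N.X k') (fun i => Hom.app (f i) k') ∘ₗ
          ((directSum F).d k k').hom) x
      have e₁ := DirectSum.lmap_lof (fun i => ((F i).d k k').hom) i y
      have e₂ := DirectSum.toModule_lof (M := fun i => (F i).X k)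
        (φ := fun i => Hom.app (f i) k) R i y
      have e₃ := DirectSum.toModule_lof (M := fun i => (F i).X k')
        (φ := fun i => Hom.app (f i) k') R i (((F i).d k k').hom y)
      exact (congrArg _ e₂).trans ((app_d (f i) k k' y).symm.trans
        (e₃.symm.trans (congrArg _ e₁.symm))))
    (fun {p k l} h a x => by
      refine LinearMap.congr_fun (DirectSum.linearMap_ext R fun i => LinearMap.ext fun y => ?_ :
        DirectSum.toModule R I (N.X l) (fun i => Hom.app (f i) l) ∘ₗ (directSum F).smul h a =
        N.smul h a ∘ₗ DirectSum.toModule R I (N.X k) (fun i => Hom.app (f i) k)) x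
      have e₁ := DirectSum.lmap_lof (fun i => (F i).smul h a) i y
      have e₂ := DirectSum.toModule_lof (M := fun i => (F i).X k)
        (φ := fun i => Hom.app (f i) k) R i y
      have e₃ := DirectSum.toModule_lof (M := fun i => (F i).X l)
        (φ := fun i => Hom.app (f i) l) R i ((F i).smul h a y)
      exact (congrArg _ e₁).trans (e₃.trans ((app_smul (f i) h a y).trans
        (congrArg (N.smul h a) e₂.symm))))

theorem directSumIncl_desc {I : Type v} {F : I → DGModule A} {N : DGModule A}
    (f : ∀ i, F i ⟶ N) (i : I) : directSumIncl F i ≫ directSumDesc f = f i :=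
  hom_ext_app fun k x => by
    classical
    exact DirectSum.toModule_lof (M := fun i => (F i).X k) (φ := fun i => Hom.app (f i) k) R i x

theorem directSum_hom_ext {I : Type v} {F : I → DGModule A} {N : DGModule A}
    {f g : directSum F ⟶ N} (h : ∀ i, directSumIncl F i ≫ f = directSumIncl F i ≫ g) : f = g := by
  classical
  refine hom_ext_app fun k x => LinearMap.congr_fun (DirectSum.linearMap_ext R fun i =>
    LinearMap.ext fun y => ?_ : Hom.app f k = Hom.app g k) x
  have e := congrArg (fun φ => Hom.app φ k y) (h i)
  dsimp only [comp_app] at e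
  exact e

/-- The range of a morphism. -/
def range {M N : DGModule A} (f : M ⟶ N) : DGSubmodule N where
  carrier i := LinearMap.range (Hom.app f i)
  d_mem i j x hx := by
    obtain ⟨y, rfl⟩ := hx
    exact ⟨_, app_d f i j y⟩
  smul_mem h a x hx := by
    obtain ⟨y, rfl⟩ := hx
    exact ⟨_, app_smul f h a y⟩

/-- The kernel of a morphism. -/
def kernel {M N : DGModule A} (f : M ⟶ N) : DGSubmodule M where
  carrier i := LinearMap.ker (Hom.app f i)
  d_mem i j x hx := by
    rw [LinearMap.mem_ker] at hx ⊢
    rw [app_d, hx, map_zero]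
  smul_mem h a x hx := by
    rw [LinearMap.mem_ker] at hx ⊢
    rw [app_smul, hx, map_zero]

theorem isSurjective_of_epi {M N : DGModule A} (f : M ⟶ N) [Epi f] : IsSurjective f := by
  intro i x
  have e : (range f).proj = 0 := by
    rw [← cancel_epi f, Limits.comp_zero]
    exact hom_ext_app fun k y =>
      (Submodule.Quotient.mk_eq_zero (LinearMap.range (Hom.app f k))).2 ⟨y, rfl⟩
  have e' : Hom.app (range f).proj i x = 0 := by rw [e]; rfl
  exact (Submodule.Quotient.mk_eq_zero (LinearMap.range (Hom.app f i))).1 e'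

theorem exact_kernel {L M N : DGModule A} {g : M ⟶ N} {p : L ⟶ (kernel g).toDGModule}
    (hp : IsSurjective p) {P : DGModule A} (q : N ⟶ P) (hq : ∀ i, Function.Injective (Hom.app q i))
    (i : ℤ) : Function.Exact (Hom.app (p ≫ (kernel g).incl) i) (Hom.app (g ≫ q) i) := by
  intro x
  rw [comp_app, map_eq_zero_iff _ (hq i)]
  constructor
  · intro hx
    obtain ⟨y, hy⟩ := hp i ⟨x, hx⟩
    refine ⟨y, ?_⟩
    rw [comp_app, hy]
    rfl
  · rintro ⟨y, rfl⟩
    exact (Hom.app p i y).2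

/-- The direct sum of the free DG modules on the homogeneous elements of `M`. -/
noncomputable abbrev cover (M : DGModule A) : DGModule A :=
  directSum fun x : Σ j : ℤ, M.X j => disc A x.1

/-- The canonical morphism from the free DG module on the homogeneous elements of `M`. -/
noncomputable def coverπ (M : DGModule A) : cover M ⟶ M :=
  directSumDesc fun x : Σ j : ℤ, M.X j => discHom x.2

theorem coverπ_surjective (M : DGModule A) : IsSurjective (coverπ M) := fun j m => by
  refine ⟨Hom.app (directSumIncl _ ⟨j, m⟩) j (discGen A j), ?_⟩
  rw [← comp_app, coverπ, directSumIncl_desc]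
  exact discHom_gen m

instance (M : DGModule A) : Projective (cover M) where
  factors {E X} f e _ := by
    choose g hg using fun x : Σ j : ℤ, M.X j => isSurjective_of_epi e x.1
      (Hom.app (directSumIncl _ x ≫ f) x.1 (discGen A x.1))
    refine ⟨directSumDesc fun x => discHom (g x), directSum_hom_ext fun x => ?_⟩
    rw [← Category.assoc, directSumIncl_desc,
      ← discHom_app_gen (directSumIncl (fun x : Σ j : ℤ, M.X j => disc A x.1) x ≫ f), ← hg x,
      ← discHom_app_gen (discHom (g x) ≫ e), comp_app, discHom_gen]

/-- The iterated kernels of the canonical morphisms `cover M → M`. -/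
noncomputable def syzygy (M : DGModule A) : ℕ → DGModule A
  | 0 => M
  | n + 1 => (kernel (coverπ (syzygy M n))).toDGModule

/-- Every DG module has a resolution by categorically projective DG modules. -/
theorem nonempty_projectiveResolution (M : DGModule A) : Nonempty (ProjectiveResolution M) :=
  ⟨{P := fun j => cover (syzygy M j)
    projective := fun _ => inferInstance
    d := fun j => coverπ (syzygy M (j + 1)) ≫ (kernel (coverπ (syzygy M j))).incl
    π := coverπ M
    exact_succ := fun j i => exact_kernel (coverπ_surjective (syzygy M (j + 2)))
      (kernel (coverπ (syzygy M j))).incl (fun _ => Subtype.val_injective) i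
    exact_zero := fun i => exact_kernel (coverπ_surjective (syzygy M 1)) (𝟙 M)
      (fun _ => Function.injective_id) i
    surjective := coverπ_surjective M }⟩

end DGModule

/-! Both vanishing statements come from one lifting argument, `IsGradedProjective.exists_extension`.
By `ProjectiveResolution.isZero_YExt_one` it suffices to extend each morphism `f : ker π → N` to the
middle term `P` of `0 → ker π → P → M → 0`; equivalently, to split the extension `0 → N → E → M → 0`
obtained by pushing out along `f`.

Let `t : C → M` be surjective. Since `C` is graded-projective, `t` lifts to a graded `A`-linear map
`C → E`. The failure of this lift to be a chain map is a cycle in `Hom_A(C, N)` of degree `-1`. If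
that cycle is a boundary, the lift can be corrected to a morphism of DG modules. The corrected lift
sends `ker t` into `N`, so if there is no nonzero morphism `ker t → N`, it descends to a splitting
`M → E`.

The first claim is the case `t = 𝟙 C`. For the second, `t` is the projection from `C` to its
truncation, which is also `N`. The kernel of `t` lives in degrees `≥ n` and consists of boundaries
in degree `n`, while the truncation is zero above `n`; hence there are no nonzero morphisms between
them. For `n ≥ sup C` the projection is a quasiisomorphism, so semi-projectivity identifies the
degree `-1` homology of `Hom_A(C, N)` with that of `Hom_A(C, C)`. The latter vanishes by the
hypothesis on `Ext`, once `IsSemiprojective.isZero_homology_homComplex` has replaced the given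
resolution of `C` by `C` itself. -/

namespace HomologicalComplex

/-! ### Homology of complexes of modules, in terms of elements -/

variable {R : Type u} [CommRing R] {ι : Type*} {c : ComplexShape ι}
  {K L : HomologicalComplex (ModuleCat.{v} R) c}

theorem exists_cycle_add_boundary_of_epi_homologyMap (φ : K ⟶ L) {i j k : ι} (hi : c.prev j = i)
    (hk : c.next j = k) [Epi (homologyMap φ j)] (y : L.X j) (hy : (L.d j k).hom y = 0) :
    ∃ x : K.X j, (K.d j k).hom x = 0 ∧ ∃ z : L.X i, y = (φ.f j).hom x + (L.d i j).hom z := by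
  -- The test object is the module of all cycles with its inclusion; the element form follows by
  -- evaluating at a preimage of `y` in the refinement.
  obtain ⟨B, π, hπ, x, hx, z, h⟩ :=
    (epi_homologyMap_iff_up_to_refinements φ i j k hi hk).1 inferInstance
      (A := ModuleCat.of R (LinearMap.ker (L.d j k).hom)) (ModuleCat.ofHom (Submodule.subtype _))
      (ModuleCat.hom_ext (LinearMap.ext fun w => w.2))
  obtain ⟨b, hb⟩ := (ModuleCat.epi_iff_surjective π).1 hπ ⟨y, hy⟩
  refine ⟨x.hom b, congr($hx b), z.hom b, ?_⟩
  have := congr($h b)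
  simpa [hb] using this

theorem exactAt_iff_function_exact {i j k : ι} (hi : c.prev j = i) (hk : c.next j = k) :
    K.ExactAt j ↔ ∀ x, (K.d j k).hom x = 0 → ∃ y, (K.d i j).hom y = x := by
  rw [exactAt_iff' K i j k hi hk, ShortComplex.moduleCat_exact_iff]
  rfl

/-- Long exact homology sequence of `0 → J → K → L → 0`: the terms coming from `J` vanish. -/
theorem quasiIso_of_surjective_of_acyclic_ker {J : HomologicalComplex (ModuleCat.{v} R) c}
    (φ : J ⟶ K) (ψ : K ⟶ L) (hφ : ∀ i, Function.Injective (φ.f i).hom)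
    (hψ : ∀ i, Function.Surjective (ψ.f i).hom)
    (hex : ∀ i, Function.Exact (φ.f i).hom (ψ.f i).hom) (hJ : J.Acyclic) : QuasiIso ψ := by
  have w : φ ≫ ψ = 0 := by
    ext i x
    exact (hex i).apply_apply_eq_zero x
  have hS : (ShortComplex.mk φ ψ w).ShortExact :=
    shortExact_of_degreewise_shortExact _ fun i =>
      { exact := (ShortComplex.moduleCat_exact_iff _).2 fun x hx => (hex i x).1 hx
        mono_f := (ModuleCat.mono_iff_injective _).2 (hφ i)
        epi_g := (ModuleCat.epi_iff_surjective _).2 (hψ i) }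
  refine ⟨fun i => ?_⟩
  rw [quasiIsoAt_iff_isIso_homologyMap]
  have : Mono (homologyMap ψ i) :=
    (hS.homology_exact₂ i).mono_g ((hJ i).isZero_homology.eq_of_src _ _)
  have : Epi (homologyMap ψ i) := by
    by_cases! hi : ∃ j, c.Rel i j
    · obtain ⟨j, hij⟩ := hi
      exact (hS.homology_exact₃ i j hij).epi_f ((hJ j).isZero_homology.eq_of_tgt _ _)
    -- With no outgoing differential at `i`, homology there is a cokernel, so it preserves
    -- surjections and no connecting map is needed.
    · have := hS.epi_g
      exact epi_homologyMap_of_epi_of_not_rel ψ i hi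
  exact isIso_of_mono_of_epi _

end HomologicalComplex

theorem LinearMap.exists_comp_eq_of_ker_le {R X Y Z : Type*} [Ring R] [AddCommGroup X]
    [AddCommGroup Y] [AddCommGroup Z] [Module R X] [Module R Y] [Module R Z] (p : X →ₗ[R] Y)
    (hp : Function.Surjective p) (f : X →ₗ[R] Z) (h : LinearMap.ker p ≤ LinearMap.ker f) :
    ∃ g : Y →ₗ[R] Z, ∀ x, g (p x) = f x := by
  refine ⟨(LinearMap.ker p).liftQ f h ∘ₗ (p.quotKerEquivOfSurjective hp).symm.toLinearMap,
    fun x => ?_⟩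
  have e : p x = p.quotKerEquivOfSurjective hp (Submodule.Quotient.mk x) := rfl
  rw [LinearMap.comp_apply, LinearEquiv.coe_coe, e, LinearEquiv.symm_apply_apply]
  rfl

namespace DGModule

variable {R : Type u} [CommRing R] {A : DGAlgebra.{v} R}

/-! ### Calculus of homogeneous homomorphisms -/

namespace homDeg

/-- The identity of `M` as an element of `Hom_A(M, M)_0`. -/
def id (M : DGModule A) : homDeg M M 0 :=
  ⟨fun p => (eqToHom (congrArg M.X (by have := p.2; omega : p.1.1 = p.1.2))).hom, by
    intro p i j k l h h' hi hk a m
    obtain rfl : i = j := by omega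
    obtain rfl : k = l := by omega
    simp⟩

theorem id_app (M : DGModule A) (i : ℤ) (h : i + 0 = i) (m : M.X i) :
    homDeg.app (id M) i i h m = m := rfl

/-- A morphism `M ⟶ N` as an element of `Hom_A(M, N)_0`. -/
def ofHom {M N : DGModule A} (f : M ⟶ N) : homDeg M N 0 := homPost M f 0 (id M)

theorem ofHom_app {M N : DGModule A} (f : M ⟶ N) (i : ℤ) (h : i + 0 = i) (m : M.X i) :
    homDeg.app (ofHom f) i i h m = Hom.app f i m := rfl

/-- The composite of homogeneous homomorphisms. -/
def comp {M N P : DGModule A} {m n l : ℤ} (f : homDeg N P n) (g : homDeg M N m)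
    (h : m + n = l) : homDeg M P l :=
  ⟨fun p => homDeg.app f (p.1.1 + m) p.1.2 (by have := p.2; omega) ∘ₗ
      homDeg.app g p.1.1 (p.1.1 + m) rfl, by
    intro p i j k l' h₁ h₂ hi hk a x
    rw [LinearMap.comp_apply,
      homDeg.map_smul g h₁ (by omega : p + (i + m) = k + m) rfl rfl a x, map_sign_smul,
      homDeg.map_smul f (by omega : p + (i + m) = k + m) h₂ (by omega) (by omega), smul_smul,
      ← Int.negOnePow_add, ← add_mul, h]
    rfl⟩

/-- The intermediate degree `j` is left free, so that degree equations are settled by arithmetic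
instead of transport. -/
theorem comp_app {M N P : DGModule A} {m n l : ℤ} (f : homDeg N P n) (g : homDeg M N m)
    (h : m + n = l) {i j k : ℤ} (hi : i + l = k) (hj : i + m = j) (hk : j + n = k) (x : M.X i) :
    homDeg.app (comp f g h) i k hi x = homDeg.app f j k hk (homDeg.app g i j hj x) := by
  subst hj
  rfl

theorem zero_app {M N : DGModule A} {n : ℤ} (i j : ℤ) (h : i + n = j) (x : M.X i) :
    homDeg.app (0 : homDeg M N n) i j h x = 0 := rfl

theorem units_smul_app {M N : DGModule A} {n : ℤ} (e : ℤˣ) (f : homDeg M N n) (i j : ℤ)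
    (h : i + n = j) (x : M.X i) : homDeg.app (e • f) i j h x = e • homDeg.app f i j h x := by
  rcases Int.units_eq_one_or e with rfl | rfl
  · rw [_root_.one_smul, _root_.one_smul]
  · rw [Units.neg_smul, Units.neg_smul, _root_.one_smul, _root_.one_smul]
    rfl

end homDeg

theorem homD_app {M N : DGModule A} {n n' : ℤ} (h : n' + 1 = n) (f : homDeg M N n)
    {i i' j j' : ℤ} (hi : i' + 1 = i) (hj : j' + 1 = j) (h₁ : i + n' = j') (h₂ : i + n = j)
    (h₃ : i' + n = j') (m : M.X i) :
    homDeg.app (homD M N h f) i j' h₁ m =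
      (N.d j j').hom (homDeg.app f i j h₂ m) -
        n.negOnePow • homDeg.app f i' j' h₃ ((M.d i i').hom m) :=
  homDFun_app h f hi hj h₁ h₂ h₃ m

/-- The Leibniz rule for composites of homogeneous homomorphisms. -/
theorem homD_comp {M N P : DGModule A} {m n l m' n' l' : ℤ} (f : homDeg N P n) (g : homDeg M N m)
    (h : m + n = l) (hm : m' + 1 = m) (hn : n' + 1 = n) (hl : l' + 1 = l) :
    homD M P hl (homDeg.comp f g h) =
      homDeg.comp (homD N P hn f) g (by omega) +
        n.negOnePow • homDeg.comp f (homD M N hm g) (by omega) := by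
  refine homDeg.ext_app fun i k hik x => ?_
  rw [homD_app hl _ (sub_add_cancel i 1) rfl hik (by omega) (by omega), homDeg.add_app,
    LinearMap.add_apply, homDeg.units_smul_app,
    homDeg.comp_app _ _ _ _ rfl (by omega), homDeg.comp_app _ _ _ _ rfl (by omega),
    homDeg.comp_app _ _ _ _ rfl (by omega),
    homDeg.comp_app _ _ _ _ (by omega : i + m' = i - 1 + m) (by omega),
    homD_app hn _ (by omega : i - 1 + m + 1 = i + m) rfl (by omega) (by omega) (by omega),
    homD_app hm _ (sub_add_cancel i 1) (by omega : i - 1 + m + 1 = i + m) (by omega) (by omega)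
      (by omega), map_sub, map_sign_smul, smul_sub, smul_smul,
    ← Int.negOnePow_add, add_comm n m, h]
  abel

theorem homD_ofHom {M N : DGModule A} (f : M ⟶ N) :
    homD M N (neg_add_cancel 1) (homDeg.ofHom f) = 0 := by
  refine homDeg.ext_app fun i k hik x => ?_
  obtain rfl : k = i - 1 := by omega
  rw [homD_app _ _ (sub_add_cancel i 1) (sub_add_cancel i 1) hik (add_zero _) (add_zero _),
    homDeg.ofHom_app, homDeg.ofHom_app, app_d, Int.negOnePow_zero, _root_.one_smul, sub_self]
  rfl

theorem homComplex_d (M N : DGModule A) {n n' : ℤ} (h : n' + 1 = n) :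
    (homComplex M N).d n n' = ModuleCat.ofHom (homD M N h) := dif_pos h

/-! ### Independence of `Ext` from the resolution of a semi-projective module -/

theorem prev_down {i j : ℤ} (h : j + 1 = i) : (ComplexShape.down ℤ).prev j = i :=
  (ComplexShape.down ℤ).prev_eq' h

theorem next_down {i j : ℤ} (h : j + 1 = i) : (ComplexShape.down ℤ).next i = j :=
  (ComplexShape.down ℤ).next_eq' h

theorem exists_homD_eq {M N : DGModule A} {n n₁ n₂ : ℤ} (h₁ : n + 1 = n₁) (h₂ : n₂ + 1 = n)
    (hH : Limits.IsZero ((homComplex M N).homology n)) (f : homDeg M N n)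
    (hf : homD M N h₂ f = 0) : ∃ g : homDeg M N n₁, homD M N h₁ g = f := by
  have e := (HomologicalComplex.exactAt_iff_function_exact (prev_down h₁) (next_down h₂)).1
    ((homComplex M N).exactAt_iff_isZero_homology n |>.2 hH)
  rw [homComplex_d M N h₁, homComplex_d M N h₂] at e
  exact e f hf

theorem isZero_homology_homComplex {M N : DGModule A} {n n₁ n₂ : ℤ} (h₁ : n + 1 = n₁)
    (h₂ : n₂ + 1 = n)
    (h : ∀ f : homDeg M N n, homD M N h₂ f = 0 → ∃ g : homDeg M N n₁, homD M N h₁ g = f) :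
    Limits.IsZero ((homComplex M N).homology n) := by
  rw [← HomologicalComplex.exactAt_iff_isZero_homology,
    HomologicalComplex.exactAt_iff_function_exact (prev_down h₁) (next_down h₂),
    homComplex_d M N h₁, homComplex_d M N h₂]
  exact h

/-- A quasiisomorphism to a semi-projective DG module has a right inverse up to homotopy. -/
theorem IsSemiprojective.exists_homotopy_section {C L : DGModule A} (hC : C.IsSemiprojective)
    (π : L ⟶ C) (hπ : IsQuasiIso π) :
    ∃ s : homDeg C L 0, homD C L (neg_add_cancel 1) s = 0 ∧ ∃ h : homDeg C C 1,
      homDeg.id C = homPost C π 0 s + homD C C (zero_add 1) h := by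
  -- `Hom_A(C, π)` is a quasiisomorphism, so the homology class of the identity of `C` comes from a
  -- cycle `s` in `Hom_A(C, L)`.
  have := hC.2 π hπ
  have e := HomologicalComplex.exists_cycle_add_boundary_of_epi_homologyMap (homMap C π)
    (prev_down (zero_add 1)) (next_down (neg_add_cancel 1)) (homDeg.id C)
  rw [homComplex_d _ _ (zero_add 1), homComplex_d _ _ (neg_add_cancel 1),
    homComplex_d _ _ (neg_add_cancel 1)] at e
  exact e (homD_ofHom (𝟙 C))

/-- `Ext` out of a semi-projective DG module is the homology of the Hom complex. -/
theorem IsSemiprojective.isZero_homology_homComplex {C N : DGModule A} (hC : C.IsSemiprojective)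
    (L : SemiprojectiveResolution C) (n : ℤ) (hExt : Limits.IsZero (Ext L N n)) :
    Limits.IsZero ((homComplex C N).homology (-n)) := by
  obtain ⟨s, hs, h, e⟩ := hC.exists_homotopy_section L.π L.quasiIso
  refine DGModule.isZero_homology_homComplex rfl (sub_add_cancel _ 1) fun φ hφ => ?_
  -- For a cycle `φ`, the cycle `φπ` is a boundary `∂ψ`. Writing `1 = πs + ∂h` then gives `φ = φπs +
  -- φ∂h = ∂(ψs) + (-1)^n ∂(φh)`.
  obtain ⟨ψ, hψ⟩ := exists_homD_eq rfl (sub_add_cancel _ 1) hExt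
    (homDeg.comp φ (homDeg.ofHom L.π) (zero_add _)) (by
      rw [homD_comp _ _ _ (neg_add_cancel 1) (sub_add_cancel _ 1), hφ, homD_ofHom]
      refine homDeg.ext_app fun i k hik x => ?_
      rw [homDeg.add_app, LinearMap.add_apply, homDeg.units_smul_app,
        homDeg.comp_app _ _ _ _ rfl (by omega), homDeg.comp_app _ _ _ _ rfl (by omega),
        homDeg.zero_app, homDeg.zero_app, map_zero, smul_zero, add_zero]
      rfl)
  have e₁ : homD C N rfl (homDeg.comp ψ s (zero_add _)) =
      homDeg.comp φ (homPost C L.π 0 s) (zero_add _) := by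
    rw [homD_comp _ _ _ (neg_add_cancel 1) rfl, hψ, hs]
    refine homDeg.ext_app fun i k hik x => ?_
    rw [homDeg.add_app, LinearMap.add_apply, homDeg.units_smul_app,
      homDeg.comp_app _ _ _ _ (add_zero i) (by omega),
      homDeg.comp_app _ _ _ _ (add_zero i) (by omega),
      homDeg.comp_app _ _ _ _ (add_zero i) (by omega),
      homDeg.comp_app _ _ _ _ rfl (by omega), homDeg.zero_app, map_zero, smul_zero, add_zero]
    rfl
  have e₂ : homD C N rfl (homDeg.comp φ h (add_comm 1 (-n))) =
      (-n).negOnePow • homDeg.comp φ (homD C C (zero_add 1) h) (zero_add _) := by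
    rw [homD_comp _ _ _ (zero_add 1) (sub_add_cancel _ 1), hφ, add_eq_right]
    exact homDeg.ext_app fun i k hik x => homDeg.comp_app _ _ _ _ rfl (by omega) x
  refine ⟨homDeg.comp ψ s (zero_add _) +
    (-n).negOnePow • homDeg.comp φ h (add_comm 1 (-n)), ?_⟩
  rw [map_add, map_sign_smul, e₁, e₂, smul_smul, Int.units_mul_self, _root_.one_smul]
  refine homDeg.ext_app fun i k hik x => ?_
  rw [homDeg.add_app, LinearMap.add_apply, homDeg.comp_app _ _ _ _ (add_zero i) hik,
    homDeg.comp_app _ _ _ _ (add_zero i) hik, ← map_add, ← LinearMap.add_apply, ← homDeg.add_app,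
    ← e, homDeg.id_app]

theorem homDeg.app_smul_of_degree_zero {M N : DGModule A} (f : homDeg M N 0) {p j k : ℤ}
    (h : p + j = k) (a : A.X p) (m : M.X j) :
    homDeg.app f k k (add_zero k) (M.smul h a m) =
      N.smul h a (homDeg.app f j j (add_zero j) m) := by
  rw [homDeg.map_smul f h h (add_zero j), zero_mul, Int.negOnePow_zero, _root_.one_smul]

theorem homPost_injective {Q M N : DGModule A} (f : M ⟶ N)
    (hf : ∀ i, Function.Injective (Hom.app f i)) (n : ℤ) :
    Function.Injective (homPost Q f n) := fun g g' h =>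
  homDeg.ext_app fun i j hij m => hf j (by
    rw [← homPost_app, ← homPost_app, h])

/-! ### Kernels of morphisms and factorizations -/

section Kernel

variable {M N : DGModule A} {p : M ⟶ N}

/-- The element of the kernel of a morphism given by an element that is mapped to zero. -/
def kernelMk {i : ℤ} (x : M.X i) (hx : Hom.app p i x = 0) : (kernel p).toDGModule.X i :=
  (⟨x, hx⟩ : LinearMap.ker (Hom.app p i))

theorem incl_kernelMk {i : ℤ} (x : M.X i) (hx : Hom.app p i x = 0) :
    Hom.app (kernel p).incl i (kernelMk x hx) = x := rfl

theorem app_incl_kernel {i : ℤ} (x : (kernel p).toDGModule.X i) :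
    Hom.app p i (Hom.app (kernel p).incl i x) = 0 :=
  LinearMap.mem_ker.1 (Subtype.prop x)

theorem kernel_incl_injective (i : ℤ) : Function.Injective (Hom.app (kernel p).incl i) :=
  Subtype.val_injective

/-- The linear map to the kernel of a morphism given by a linear map whose values are mapped to
zero. -/
def kernelLift {X : Type*} [AddCommGroup X] [Module R X] {i : ℤ} (s : X →ₗ[R] M.X i)
    (hs : ∀ x, Hom.app p i (s x) = 0) : X →ₗ[R] (kernel p).toDGModule.X i :=
  s.codRestrict (LinearMap.ker (Hom.app p i)) hs

theorem kernelLift_apply {X : Type*} [AddCommGroup X] [Module R X] {i : ℤ} (s : X →ₗ[R] M.X i)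
    (hs : ∀ x, Hom.app p i (s x) = 0) (x : X) : kernelLift s hs x = kernelMk (s x) (hs x) := rfl

/-- Left exactness of `Hom_A(Q, -)`: the inclusion of the kernel is injective, so `A`-linearity of
the corestriction can be tested in `M`. -/
theorem exists_homPost_incl_eq {Q : DGModule A} {n : ℤ} (g : homDeg Q M n)
    (hg : homPost Q p n g = 0) :
    ∃ g' : homDeg Q (kernel p).toDGModule n, homPost Q (kernel p).incl n g' = g := by
  refine ⟨⟨fun q => kernelLift (g.1 q) fun x => ?_,
    fun p i j k l h h' hi hk a m => kernel_incl_injective _ ?_⟩, rfl⟩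
  · have : Hom.app p q.1.2 (g.1 q x) = homDeg.app (homPost Q p n g) q.1.1 q.1.2 q.2 x := rfl
    rw [this, hg]
    rfl
  · rw [map_sign_smul, app_smul, kernelLift_apply, kernelLift_apply, incl_kernelMk, incl_kernelMk]
    exact g.2 p i j k l h h' hi hk a m

/-- A morphism that vanishes on the kernel of a surjective morphism factors through it. -/
theorem exists_comp_eq_of_isSurjective {P : DGModule A} (hp : IsSurjective p) (f : M ⟶ P)
    (h : ∀ i x, Hom.app p i x = 0 → Hom.app f i x = 0) : ∃ g : N ⟶ P, p ≫ g = f := by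
  choose g hg using fun i => LinearMap.exists_comp_eq_of_ker_le (Hom.app p i) (hp i)
    (Hom.app f i) fun x hx => h i x hx
  refine ⟨homMk g (fun i j y _ => ?_) (fun {i j k} h a y => ?_), hom_ext_app hg⟩
  · obtain ⟨x, rfl⟩ := hp i y
    rw [hg, ← app_d, ← app_d, hg]
  · obtain ⟨x, rfl⟩ := hp j y
    rw [hg, ← app_smul, ← app_smul, hg]

end Kernel

/-- Let `C` be graded-projective and let `t : C ⟶ M` be surjective such that every morphism from
the kernel of `t` to `N` is zero. If every cycle in `Hom_A(C, N)` of degree `-1` is a boundary,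
then a morphism to `N` extends along the kernel of any surjective morphism to `M`. -/
theorem IsGradedProjective.exists_extension {C M N P : DGModule A} (hC : C.IsGradedProjective)
    (t : C ⟶ M) (ht : IsSurjective t) (hker : ∀ φ : (kernel t).toDGModule ⟶ N, φ = 0)
    (hCN : ∀ φ : homDeg C N (-1), homD C N (sub_add_cancel (-1) 1) φ = 0 →
      ∃ η : homDeg C N 0, homD C N (neg_add_cancel 1) η = φ)
    (π : P ⟶ M) (hπ : IsSurjective π) (f : (kernel π).toDGModule ⟶ N) :
    ∃ g : P ⟶ N, (kernel π).incl ≫ g = f := by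
  -- Graded-projectivity lifts `t` only to an `A`-linear map `σ`, which need not commute with the
  -- differentials.
  obtain ⟨σ, hσ⟩ : ∃ σ : homDeg C P 0, homPost C π 0 σ = homDeg.ofHom t :=
    hC π hπ 0 (homDeg.ofHom t)
  have hσ' (i : ℤ) (c : C.X i) :
      Hom.app π i (homDeg.app σ i i (add_zero i) c) = Hom.app t i c := by
    rw [← homPost_app C π σ, hσ, homDeg.ofHom_app]
  -- The defect `∂σ` takes values in `ker π`, because `πσ = t` is a chain map; `δ` is this defect
  -- with restricted target.
  obtain ⟨δ, hδ⟩ := exists_homPost_incl_eq (p := π) (homD C P (neg_add_cancel 1) σ) (by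
    rw [← homD_homPost, hσ, homD_ofHom])
  have hδ' {i j : ℤ} (h : j + 1 = i) (c : C.X i) :
      Hom.app (kernel π).incl j (homDeg.app δ i j (by omega) c) =
        (P.d i j).hom (homDeg.app σ i i (add_zero i) c) -
          homDeg.app σ j j (add_zero j) ((C.d i j).hom c) := by
    rw [← homPost_app, hδ, homD_app _ _ h h _ (add_zero i) (add_zero j), Int.negOnePow_zero,
      _root_.one_smul]
  have hδ₀ : homD C _ (sub_add_cancel (-1) 1) δ = 0 :=
    homPost_injective (kernel π).incl kernel_incl_injective _ (by
      rw [← homD_homPost, hδ, map_zero]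
      have := (homComplex C P).d_comp_d 0 (-1) (-1 - 1)
      rw [homComplex_d _ _ (neg_add_cancel 1), homComplex_d _ _ (sub_add_cancel (-1) 1)] at this
      exact congr($this σ))
  -- The obstruction cycle `fδ` is a boundary `∂η`; `η` is the correction to the lift.
  obtain ⟨η, hη⟩ := hCN (homPost C f (-1) δ) (by rw [homD_homPost, hδ₀, map_zero])
  have hη' {i j : ℤ} (h : j + 1 = i) (c : C.X i) :
      (N.d i j).hom (homDeg.app η i i (add_zero i) c) =
        homDeg.app η j j (add_zero j) ((C.d i j).hom c) +
          Hom.app f j (homDeg.app δ i j (by omega) c) := by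
    rw [← homPost_app, ← hη, homD_app _ _ h h _ (add_zero i) (add_zero j), Int.negOnePow_zero,
      _root_.one_smul, add_sub_cancel]
  have key {i : ℤ} (c : C.X i) (hc : Hom.app t i c = 0) :
      Hom.app f i (kernelMk (homDeg.app σ i i (add_zero i) c) ((hσ' i c).trans hc)) =
        homDeg.app η i i (add_zero i) c := by
    -- On `ker t` the map `σ` lands in `ker π`, so `fσ - η` makes sense there. It is a chain map
    -- because `∂η = fδ` cancels the defect of `σ`; hence it is zero by `hker`.
    let θ : (kernel t).toDGModule ⟶ N := homMk
      (fun i => Hom.app f i ∘ₗ (kernelLift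
          (homDeg.app σ i i (add_zero i) ∘ₗ Hom.app (kernel t).incl i)
            fun x => (hσ' i _).trans (app_incl_kernel x)) -
        homDeg.app η i i (add_zero i) ∘ₗ Hom.app (kernel t).incl i)
      (fun i j c h => by
        simp only [LinearMap.sub_apply, LinearMap.comp_apply, map_sub, kernelLift_apply, app_d]
        rw [hη' h, ← sub_sub, sub_right_comm, ← app_d f, ← map_sub]
        refine congrArg (Hom.app f j · - _) (kernel_incl_injective j ?_)
        rw [map_sub, app_d, incl_kernelMk, hδ' h, sub_sub_cancel]
        rfl)
      (fun {i j k} h a m => by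
        simp only [LinearMap.sub_apply, LinearMap.comp_apply, map_sub, kernelLift_apply, app_smul]
        rw [homDeg.app_smul_of_degree_zero η, ← app_smul f]
        refine congrArg (Hom.app f k · - _) (kernel_incl_injective k ?_)
        rw [app_smul (kernel π).incl]
        exact homDeg.app_smul_of_degree_zero σ h a _)
    exact sub_eq_zero.1 (congrArg (fun φ => Hom.app φ i (kernelMk c hc)) (hker θ))
  have ex {i : ℤ} (p : P.X i) : ∃ c : C.X i,
      Hom.app π i (p - homDeg.app σ i i (add_zero i) c) = 0 := by
    obtain ⟨c, hc⟩ := ht i (Hom.app π i p)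
    exact ⟨c, by rw [map_sub, hσ', hc, sub_self]⟩
  -- The extension is `g(p) = f(p - σc) + ηc` for any `c` with `t(c) = π(p)`; `key` says that the
  -- choice of `c` does not matter.
  have hg (i : ℤ) : ∃ g : P.X i →ₗ[R] N.X i, ∀ (p : P.X i) (c : C.X i)
      (h : Hom.app π i (p - homDeg.app σ i i (add_zero i) c) = 0),
      g p = Hom.app f i (kernelMk _ h) + homDeg.app η i i (add_zero i) c := by
    let s : (P.X i × C.X i) →ₗ[R] P.X i :=
      LinearMap.fst R _ _ - homDeg.app σ i i (add_zero i) ∘ₗ LinearMap.snd R _ _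
    -- `W` is the fibre product of `P` and `C` over `M` in degree `i`. The formula is linear on `W`
    -- and vanishes on the kernel `{(0, c)}` of the surjection `W → P_i`, so it descends without a
    -- linear choice of `c`.
    let W := LinearMap.ker (Hom.app π i ∘ₗ s)
    obtain ⟨g, hg⟩ := LinearMap.exists_comp_eq_of_ker_le (LinearMap.fst R _ _ ∘ₗ W.subtype)
      (fun p => ⟨⟨(p, (ex p).choose), (ex p).choose_spec⟩, rfl⟩)
      (Hom.app f i ∘ₗ kernelLift (s ∘ₗ W.subtype) (fun w => w.2) +
        homDeg.app η i i (add_zero i) ∘ₗ LinearMap.snd R _ _ ∘ₗ W.subtype) (by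
        rintro ⟨⟨p, c⟩, hw⟩ hp
        obtain rfl : p = 0 := hp
        have hw' : Hom.app π i (0 - homDeg.app σ i i (add_zero i) c) = 0 := hw
        have hc := hw'
        rw [map_sub, map_zero, hσ', zero_sub, neg_eq_zero] at hc
        change Hom.app f i (kernelMk (0 - homDeg.app σ i i (add_zero i) c) hw') +
          homDeg.app η i i (add_zero i) c = 0
        rw [← key c hc, ← map_add]
        refine (congrArg _ (kernel_incl_injective i ?_)).trans (map_zero _)
        rw [map_add, incl_kernelMk, incl_kernelMk, sub_add_cancel, map_zero])
    exact ⟨g, fun p c h => hg ⟨(p, c), h⟩⟩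
  choose g hg using hg
  refine ⟨homMk g (fun i j p h => ?_) (fun {i j k} h a p => ?_), hom_ext_app fun i p => ?_⟩
  · obtain ⟨c, hc⟩ := ex p
    -- Take `∂c` as the partner of `∂p`: then `∂p - σ∂c = ∂(p - σc) + δc`, and the extra term `fδc`
    -- is matched by `∂η`.
    have e : (P.d i j).hom p - homDeg.app σ j j (add_zero j) ((C.d i j).hom c) =
        Hom.app (kernel π).incl j (((kernel π).toDGModule.d i j).hom (kernelMk _ hc) +
          homDeg.app δ i j (by omega) c) := by
      rw [map_add, app_d, incl_kernelMk, hδ' h, map_sub, sub_add_sub_cancel]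
    rw [hg i p c hc, hg j _ _ (e ▸ app_incl_kernel _), map_add, hη' h, ← app_d f, add_left_comm,
      ← map_add, add_comm]
    exact congrArg (Hom.app f j · + _) (kernel_incl_injective j e.symm)
  · obtain ⟨c, hc⟩ := ex p
    have e : P.smul h a p - homDeg.app σ k k (add_zero k) (C.smul h a c) =
        Hom.app (kernel π).incl k ((kernel π).toDGModule.smul h a (kernelMk _ hc)) := by
      rw [app_smul, incl_kernelMk, map_sub, homDeg.app_smul_of_degree_zero]
    rw [hg j p c hc, hg k _ _ (e ▸ app_incl_kernel _), map_add, ← app_smul f,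
      homDeg.app_smul_of_degree_zero η]
    exact congrArg (Hom.app f k · + _) (kernel_incl_injective k e)
  -- For `p` in `ker π` one may choose `c = 0`, so `g` restricts to `f`.
  · have e : Hom.app (kernel π).incl i p - homDeg.app σ i i (add_zero i) 0 =
        Hom.app (kernel π).incl i p := by rw [map_zero, sub_zero]
    refine (hg i (Hom.app (kernel π).incl i p) 0 (by rw [e, app_incl_kernel])).trans ?_
    rw [map_zero (homDeg.app η i i (add_zero i)), add_zero]
    exact congrArg _ (kernel_incl_injective i e)

/-- By exactness, 1-cocycles `P₁ → N` are the morphisms that factor through `P₁ → ker π`, and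
coboundaries are those whose factor extends to `P₀`. -/
theorem ProjectiveResolution.isZero_YExt_one {M N : DGModule A} (P : ProjectiveResolution M)
    (h : ∀ f : (kernel P.π).toDGModule ⟶ N, ∃ g : P.P 0 ⟶ N, (kernel P.π).incl ≫ g = f) :
    Limits.IsZero (YExt P N 1) := by
  unfold YExt
  rw [← HomologicalComplex.exactAt_iff_isZero_homology,
    HomologicalComplex.exactAt_iff' _ 0 1 2 (by simp) (by simp), ShortComplex.ab_exact_iff]
  change ∀ f : P.P 1 ⟶ N, ((P.homCochain N).d 1 2).hom f = 0 →
    ∃ g : P.P 0 ⟶ N, ((P.homCochain N).d 0 1).hom g = f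
  have e (j : ℕ) : (P.homCochain N).d j (j + 1) =
      AddCommGrpCat.ofHom (Preadditive.leftComp N (P.d j)) :=
    CochainComplex.of_d (fun j => AddCommGrpCat.of (P.P j ⟶ N))
      (fun j => AddCommGrpCat.ofHom (Preadditive.leftComp N (P.d j))) j
  rw [e 0, e 1]
  intro f (hf : P.d 1 ≫ f = 0)
  let q : P.P 1 ⟶ (kernel P.π).toDGModule := homMk
    (fun i => kernelLift (Hom.app (P.d 0) i) fun x => (P.exact_zero i).apply_apply_eq_zero x)
    (fun i j x _ => kernel_incl_injective j (by
      rw [app_d, kernelLift_apply, kernelLift_apply, incl_kernelMk, incl_kernelMk, app_d]))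
    (fun {i j k} h a x => kernel_incl_injective k (by
      rw [app_smul, kernelLift_apply, kernelLift_apply, incl_kernelMk, incl_kernelMk, app_smul]))
  have hq : q ≫ (kernel P.π).incl = P.d 0 := rfl
  obtain ⟨f', rfl⟩ := exists_comp_eq_of_isSurjective (p := q)
    (fun i x => by
      obtain ⟨y, hy⟩ := (P.exact_zero i _).1 (app_incl_kernel x)
      exact ⟨y, kernel_incl_injective i hy⟩)
    f (fun i x hx => by
      obtain ⟨y, rfl⟩ := (P.exact_succ 0 i x).1 (by rw [← hq, comp_app, hx, map_zero])
      rw [← comp_app, hf]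
      rfl)
  obtain ⟨g, rfl⟩ := h f'
  exact ⟨g, rfl⟩

/-! ### The truncation and the kernel of its projection -/

theorem isZero_homology_of_sup_le {M : DGModule A} {n i : ℤ}
    (hn : M.sup ≤ ((n : WithTop ℤ) : WithBot (WithTop ℤ))) (hi : n < i) :
    Limits.IsZero (M.toHomologicalComplex.homology i) := by
  by_contra h
  have := (le_sSup ⟨i, rfl, h⟩ : _ ≤ M.sup).trans hn
  rw [WithBot.coe_le_coe, WithTop.coe_le_coe] at this
  omega

theorem mem_truncSubmodule_of_lt {M : DGModule A} {n i : ℤ} (h : n < i) (x : M.X i) :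
    x ∈ (truncSubmodule M n).carrier i := by
  simp only [truncSubmodule, if_pos h]
  trivial

theorem mem_truncSubmodule_self {M : DGModule A} {n : ℤ} {x : M.X n} :
    x ∈ (truncSubmodule M n).carrier n ↔ ∃ y, (M.d (n + 1) n).hom y = x := by
  simp only [truncSubmodule, lt_irrefl, if_false, if_true, LinearMap.mem_range]

theorem mem_truncSubmodule_of_gt {M : DGModule A} {n i : ℤ} (h : i < n) {x : M.X i} :
    x ∈ (truncSubmodule M n).carrier i ↔ x = 0 := by
  simp only [truncSubmodule, if_neg h.not_gt, if_neg h.ne, Submodule.mem_bot]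

/-- The projection `C ⟶ τ(C)_{(≤ n)}` is a quasiisomorphism for `n ≥ sup(C)`. -/
theorem isQuasiIso_proj_truncSubmodule (M : DGModule A) (n : ℤ)
    (hn : M.sup ≤ ((n : WithTop ℤ) : WithBot (WithTop ℤ))) :
    IsQuasiIso (truncSubmodule M n).proj := by
  refine HomologicalComplex.quasiIso_of_surjective_of_acyclic_ker
    (Hom.toChainMap (truncSubmodule M n).incl) _ (fun i => Subtype.val_injective)
    (fun i => Submodule.mkQ_surjective _) (fun i => LinearMap.exact_subtype_mkQ _) fun i => ?_
  rw [HomologicalComplex.exactAt_iff_function_exact (prev_down rfl) (next_down (sub_add_cancel i 1))]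
  intro x hx
  replace hx : (M.d i (i - 1)).hom x.1 = 0 := congrArg Subtype.val hx
  suffices ∃ y ∈ (truncSubmodule M n).carrier (i + 1), (M.d (i + 1) i).hom y = x.1 by
    obtain ⟨y, hy, e⟩ := this
    exact ⟨⟨y, hy⟩, Subtype.ext e⟩
  -- Above `n` the kernel agrees with `M`, which has no homology there. In degree `n` it consists of
  -- boundaries by construction, and below `n` it is zero.
  rcases lt_or_ge n i with hi | hi
  · obtain ⟨y, hy⟩ := (HomologicalComplex.exactAt_iff_function_exact (prev_down rfl)
      (next_down (sub_add_cancel i 1))).1 ((M.toHomologicalComplex.exactAt_iff_isZero_homology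
        i).2 (isZero_homology_of_sup_le hn hi)) x.1 hx
    exact ⟨y, mem_truncSubmodule_of_lt (by omega) y, hy⟩
  · rcases hi.eq_or_lt with rfl | hi
    · obtain ⟨y, hy⟩ := mem_truncSubmodule_self.1 x.2
      exact ⟨y, mem_truncSubmodule_of_lt (by omega) y, hy⟩
    · exact ⟨0, zero_mem _, by rw [map_zero, (mem_truncSubmodule_of_gt hi).1 x.2]⟩

/-- Every morphism from the kernel of `M ⟶ τ(M)_{(≤ n)}` to `τ(M)_{(≤ n)}` is zero. -/
theorem hom_kernel_proj_truncSubmodule_eq_zero (M : DGModule A) (n : ℤ)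
    (φ : (kernel (truncSubmodule M n).proj).toDGModule ⟶ M.trunc n) : φ = 0 := by
  have hT {i : ℤ} (hi : n < i) (y : (truncSubmodule M n).quotient.X i) : y = 0 := by
    obtain ⟨y, rfl⟩ := Submodule.Quotient.mk_surjective _ y
    exact (Submodule.Quotient.mk_eq_zero _).2 (mem_truncSubmodule_of_lt hi y)
  refine hom_ext_app fun i x => ?_
  change Hom.app φ i x = 0
  have hx : Hom.app (kernel (truncSubmodule M n).proj).incl i x ∈
      (truncSubmodule M n).carrier i :=
    (Submodule.Quotient.mk_eq_zero ((truncSubmodule M n).carrier i)).1 (app_incl_kernel x)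
  rcases lt_trichotomy n i with hi | rfl | hi
  · exact hT hi _
  -- In degree `n` the element is the differential of some `y` of degree `n + 1` in the kernel, and
  -- `φ(y) = 0` because the target vanishes above `n`.
  · obtain ⟨y, hy⟩ := mem_truncSubmodule_self.1 hx
    obtain rfl : ((kernel (truncSubmodule M n).proj).toDGModule.d (n + 1) n).hom
        (kernelMk y (hT (lt_add_one n) _)) = x := kernel_incl_injective n (by
      rw [app_d, incl_kernelMk, hy])
    rw [app_d φ]
    exact (congrArg _ (hT (lt_add_one n) _)).trans (map_zero _)
  · have : x = 0 := kernel_incl_injective i (by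
      rw [(mem_truncSubmodule_of_gt hi).1 hx, map_zero])
    rw [this, map_zero]

end DGModule

/-! ### The proposition -/

theorem proposition4p4 {R : Type u} [CommRing R] (A : DGAlgebra.{v} R) (C : DGModule A)
    (hC : C.IsSemiprojective) (L : DGModule.SemiprojectiveResolution C)
    (hExt : Limits.IsZero (DGModule.Ext L C 1)) :
    (∀ P : DGModule.ProjectiveResolution C, Limits.IsZero (DGModule.YExt P C 1)) ∧
      ∀ n : ℤ, C.sup ≤ ((n : WithTop ℤ) : WithBot (WithTop ℤ)) →
        ∀ P : DGModule.ProjectiveResolution (C.trunc n),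
          Limits.IsZero (DGModule.YExt P (C.trunc n) 1) := by
  have hCC := hC.isZero_homology_homComplex L 1 hExt
  refine ⟨fun P => P.isZero_YExt_one fun f => hC.1.exists_extension (𝟙 C)
    (fun i => Function.surjective_id) (fun φ => DGModule.hom_ext_app fun i x => ?_)
    (DGModule.exists_homD_eq _ _ hCC) P.π P.surjective f, fun n hn P => P.isZero_YExt_one fun f =>
    hC.1.exists_extension (DGModule.truncSubmodule C n).proj (fun i => Submodule.mkQ_surjective _)
      (DGModule.hom_kernel_proj_truncSubmodule_eq_zero C n) (DGModule.exists_homD_eq _ _ ?_)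
      P.π P.surjective f⟩
  · have : x = 0 := Subtype.ext (LinearMap.mem_ker.1 x.2)
    rw [this, map_zero, map_zero]
  -- `Hom_A(C, -)` preserves the quasiisomorphism from `C` to its truncation, which carries the
  -- vanishing in degree `-1` over to the truncation.
  · have := hC.2 _ (DGModule.isQuasiIso_proj_truncSubmodule C n hn)
    exact hCC.of_iso (asIso (HomologicalComplex.homologyMap
      (DGModule.homMap C (DGModule.truncSubmodule C n).proj) (-1))).symm
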